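/- **Setting.** Let $(Proc, Act, \rightarrow)$ be a labelled transition system with an arbitrary set of actions $Act$. A process $p$ is *image-finite* if for every state $p'$ reachable from $p$ and every $a \in Act$ the set $\{p'' \mid p' \xrightarrow{a} p''\}$ is finite. Write $I(p)=\{a \mid \exists p'\; p \xrightarrow{a} p'\}$, let $T(p)\subseteq Act^*$ be the set of traces of $p$, write $p \sqsubseteq_S q$ if some simulation relates $p$ to $q$, and let $\|p\|_S$ be the class of $p$ under simulation equivalence (${\sqsubseteq_S}\cap{\sqsupseteq_S}$). **Formulas.** Hennessy–Milner formulas are built from arbitrary (possibly infinite or empty) conjunctions $\bigwedge_{i\in I}\varphi_i$, prefixes $a\varphi$ and negation $\neg\varphi$, with $p\models a\varphi$ iff $p\xrightarrow{a}p'$ and $p'\models\varphi$ for some $p'$, and the usual satisfaction for $\bigwedge$ and $\neg$; $\top$ is the empty conjunction and $0=\bigwedge_{a\in Act}\neg a\top$. A set $\mathcal L$ of formulas induces the preorder $p\sqsubseteq_{\mathcal L}q \iff \forall\varphi\in\mathcal L\,(p\models\varphi\Rightarrow q\models\varphi)$. For a constraint $N\in\{U,C,I,T,S\}$ let $\mathcal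 L'_U=\{\top\}$, $\mathcal L'_C=\{\top,\neg 0\}$, $\mathcal L'_I=\{\top,\neg 0\}\cup\{a\top\mid a\in Act\}$, let $\mathcal L'_T$ be the least set containing $\top$ and closed under all prefixes $a\,\cdot$, and let $\mathcal L'_S$ be the least set closed under prefixes and arbitrary conjunctions. Let $\mathcal L_N^{\equiv}$ (resp. $\mathcal L_N^{\neg}$) be the closure under arbitrary conjunctions of $\{\sigma,\neg\sigma\mid\sigma\in\mathcal L'_N\}$ (resp. of $\{\neg\sigma\mid\sigma\in\mathcal L'_N\}$). The unified logics are the least sets of formulas such that: - $\mathcal L'_{NS}$ contains $\sigma$ and $\neg\sigma$ for all $\sigma\in\mathcal L'_N$ and is closed under prefixes and arbitrary conjunctions; - $\mathcal L'_{\leq_N^{l}}$ (resp. $\mathcal L'_{\leq_N^{l\supseteq}}$) contains $\top$, is closed under prefixes, and contains $\sigma\wedge\varphi$ whenever it contains $\varphi$ and $\sigma\in\mathcal L_N^{\equiv}$ (resp. $\sigma\in\mathcal L_N^{\neg}$); - $\mathcal L'_{\leq_N^{lf}}$ (resp. $\mathcal L'_{\leq_N^{lf\supseteq}}$) contains $\top$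 and all of $\mathcal L_N^{\equiv}$ (resp. $\mathcal L_N^{\neg}$) and is closed under prefixes; - $\mathcal L'_{D_N}$ contains $\top$, contains $\sigma\wedge\varphi$ whenever it contains $\varphi$ and $\sigma\in\mathcal L_N^{\equiv}$, and contains $\bigwedge_{a\in X}a\varphi_a$ whenever $X\subseteq Act$ and it contains $\varphi_a$ for all $a\in X$. **Observations.** The local observations are: $L_U=\{\cdot\}$ and $L_U(p)=\cdot$; $L_C$ is the set of booleans and $L_C(p)$ is true iff $p$ has no transition; $L_I=\mathcal P(Act)$ and $L_I(p)=I(p)$; $L_T=\mathcal P(Act^*)$ and $L_T(p)=T(p)$; $L_S$ is the set of simulation equivalence classes and $L_S(p)=\|p\|_S$. The relation $X\supseteq Y$ on $L_N$ is: always true for $N=U$; "$X$ true implies $Y$ true" for $N=C$; set inclusion for $N=I,T$; and $\|p\|_S\supseteq\|q\|_S\iff q\sqsubseteq_S p$ for $N=S$. $BGO_N$ is the set of finite trees $\langle l,\{(a_i,\theta_i)\mid i\in 1..n\}\rangle$ with $l\in L_N$, $n\geq 0$, $a_i\in Act$, $\theta_i\in BGO_N$. The set $BGO_N(p)$ consists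 of the trees $\langle L_N(p),A\rangle$ with $A$ a finite subset of $\{(a,\theta)\mid \exists p'\; p\xrightarrow{a}p',\ \theta\in BGO_N(p')\}$. $LGO_N(p)$ is the set of those elements of $BGO_N(p)$ in which each node has at most one arc; they are written $X_0a_1X_1\ldots a_nX_n$. $dBGO_N(p)$ is the set of those elements of $BGO_N(p)$ in which distinct arcs leaving the same node have distinct actions. Define: - $p\leq_N^{b}q$ iff $BGO_N(p)\subseteq BGO_N(q)$, and $p\leq_N^{db}q$ iff $dBGO_N(p)\subseteq dBGO_N(q)$; - $p\leq_N^{l}q$ iff $LGO_N(p)\subseteq LGO_N(q)$; - $p\leq_N^{l\supseteq}q$ (resp. $\leq_N^{lf}$, $\leq_N^{lf\supseteq}$) iff for every $X_0a_1X_1\ldots a_nX_n\in LGO_N(p)$ there is some $Y_0a_1Y_1\ldots a_nY_n\in LGO_N(q)$, with the same actions, such that $X_i\supseteq Y_i$ for all $0\le i\le n$ (resp. $X_n=Y_n$; $X_n\supseteq Y_n$). **Theorem.** For every $N\in\{U,C,I,T,S\}$ and all image-finite processes $p,q$: 1. $p\sqsubseteq_{\mathcal L'_{NS}}q\iff p\leq_N^{b}q$;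 2. $p\sqsubseteq_{\mathcal L'_{Z}}q\iff p\mathrel{Z}q$ for each $Z\in\{\leq_N^{l},\leq_N^{l\supseteq},\leq_N^{lf},\leq_N^{lf\supseteq}\}$; 3. $p\sqsubseteq_{\mathcal L'_{D_N}}q\iff p\leq_N^{db}q$. -/

import Mathlib

universe u v w

namespace ProcessSemantics

/-! ### Labelled transition systems -/

/-- A labelled transition system: `Tr p a p'` is the transition from `p` to `p'` labelled `a`. -/
structure LTS (Proc : Type w) (Act : Type u) where
  Tr : Proc → Act → Proc → Prop

section Processes

variable {Proc : Type w} {Act : Type u}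

/-- `p'` is a state of the process `p`: it can be reached from `p` by finitely many transitions. -/
def LTS.Reachable (lts : LTS Proc Act) (p p' : Proc) : Prop :=
  Relation.ReflTransGen (fun x y => ∃ a, lts.Tr x a y) p p'

/-- A process is image-finite if no state of it has infinitely many successors under one action.
(It may have transitions for infinitely many actions.) -/
def LTS.ImageFinite (lts : LTS Proc Act) (p : Proc) : Prop :=
  ∀ p', lts.Reachable p p' → ∀ a, {p'' | lts.Tr p' a p''}.Finite

/-- The set `I(p)` of initial actions of `p`. -/
def LTS.initials (lts : LTS Proc Act) (p : Proc) : Set Act :=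
  {a | ∃ p', lts.Tr p a p'}

/-- `Run p s p'`: the process `p` can evolve to `p'` by executing the word `s`. -/
inductive LTS.Run (lts : LTS Proc Act) : Proc → List Act → Proc → Prop
  | nil (p : Proc) : LTS.Run lts p [] p
  | cons {p p' p'' : Proc} {a : Act} {s : List Act} :
      lts.Tr p a p' → LTS.Run lts p' s p'' → LTS.Run lts p (a :: s) p''

/-- The set `T(p)` of traces of `p`. -/
def LTS.traces (lts : LTS Proc Act) (p : Proc) : Set (List Act) :=
  {s | ∃ p', lts.Run p s p'}

/-- `S` is a (plain) simulation. -/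
def LTS.IsSimulation (lts : LTS Proc Act) (S : Proc → Proc → Prop) : Prop :=
  ∀ p q, S p q → ∀ a p', lts.Tr p a p' → ∃ q', lts.Tr q a q' ∧ S p' q'

/-- The simulation preorder: `p` is simulated by `q`. -/
def LTS.Sim (lts : LTS Proc Act) (p q : Proc) : Prop :=
  ∃ S, lts.IsSimulation S ∧ S p q

theorem LTS.Sim.refl (lts : LTS Proc Act) (p : Proc) : lts.Sim p p :=
  ⟨fun x y => x = y, fun _ _ h _ p' hp => ⟨p', h ▸ hp, rfl⟩, rfl⟩

theorem LTS.Sim.trans {lts : LTS Proc Act} {p q r : Proc}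
    (h₁ : lts.Sim p q) (h₂ : lts.Sim q r) : lts.Sim p r := by
  obtain ⟨S, hS, hpq⟩ := h₁
  obtain ⟨T, hT, hqr⟩ := h₂
  refine ⟨fun x z => ∃ y, S x y ∧ T y z, ?_, q, hpq, hqr⟩
  rintro x z ⟨y, hxy, hyz⟩ a x' hx
  obtain ⟨y', hy, hxy'⟩ := hS x y hxy a x' hx
  obtain ⟨z', hz, hyz'⟩ := hT y z hyz a y' hy
  exact ⟨z', hz, y', hxy', hyz'⟩

/-- Simulation equivalence. -/
def LTS.simSetoid (lts : LTS Proc Act) : Setoid Proc where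
  r p q := lts.Sim p q ∧ lts.Sim q p
  iseqv :=
    ⟨fun p => ⟨LTS.Sim.refl lts p, LTS.Sim.refl lts p⟩, fun h => ⟨h.2, h.1⟩,
      fun h k => ⟨h.1.trans k.1, k.2.trans h.2⟩⟩

/-- The simulation equivalence classes of processes. -/
def LTS.SimClass (lts : LTS Proc Act) : Type w := Quotient lts.simSetoid

/-- The simulation equivalence class of `p`. -/
def LTS.simClass (lts : LTS Proc Act) (p : Proc) : lts.SimClass := Quotient.mk lts.simSetoid p

/-- The partial order that the simulation preorder induces on simulation equivalence classes. -/
def LTS.SimClass.le {lts : LTS Proc Act} (X Y : lts.SimClass) : Prop :=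
  Quotient.liftOn₂ X Y (fun p q => lts.Sim p q) (fun _ _ _ _ h k =>
    propext ⟨fun m => h.2.trans (m.trans k.1), fun m => h.1.trans (m.trans k.2)⟩)

end Processes

/-! ### Hennessy-Milner logic -/

/-- Formulas of (infinitary) Hennessy-Milner logic over the set of actions `Act`. Conjunctions are
indexed by arbitrary sets; the index types range over a universe that contains `Act`. -/
inductive HML (Act : Type u) : Type (max (u + 1) (v + 1))
  | conj (ι : Type (max u v)) (φ : ι → HML Act) : HML Act
  | pre (a : Act) (φ : HML Act) : HML Act
  | neg (φ : HML Act) : HML Act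

namespace HML

variable {Proc : Type w} {Act : Type u}

/-- The satisfaction relation. -/
def Sat (lts : LTS Proc Act) : Proc → HML.{u, v} Act → Prop
  | p, conj _ φ => ∀ i, Sat lts p (φ i)
  | p, pre a φ => ∃ p', lts.Tr p a p' ∧ Sat lts p' φ
  | p, neg φ => ¬ Sat lts p φ

/-- `⊤`, the empty conjunction. -/
def top : HML.{u, v} Act := conj PEmpty (fun i => i.elim)

/-- Binary conjunction. -/
def and (φ ψ : HML.{u, v} Act) : HML.{u, v} Act :=
  conj (ULift Bool) (fun b => if b.down then φ else ψ)

/-- The conjunction of the formulas `a φ_a` for `a ∈ X`. -/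
def conjPre (X : Set Act) (φ : X → HML.{u, v} Act) : HML.{u, v} Act :=
  conj (ULift X) (fun a => pre a.down.1 (φ a.down))

/-- The formula `0`, the conjunction of all `¬ a ⊤` with `a ∈ Act`. -/
def zero : HML.{u, v} Act := conj (ULift Act) (fun a => neg (pre a.down top))

end HML

/-- The preorder induced by a set of formulas. -/
def LogicLE {Proc : Type w} {Act : Type u} (lts : LTS Proc Act) (𝓛 : Set (HML.{u, v} Act))
    (p q : Proc) : Prop :=
  ∀ φ ∈ 𝓛, HML.Sat lts p φ → HML.Sat lts q φ

/-! ### The unified logics -/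

/-- The constraints: universal, complete, initial offers, traces, simulation. -/
inductive Constraint : Type
  | U | C | I | T | S

/-- The semantics at each layer of the spectrum: constrained simulation `NS`, the four linear
semantics `l`, `l⊇`, `lf`, `lf⊇`, and the deterministic branching semantics `D`. -/
inductive Sem : Type
  | NS | l | lsup | lf | lfsup | D

section Logics

variable {Act : Type u}

/-- Trace formulas. -/
inductive LogicT : HML.{u, v} Act → Prop
  | top : LogicT HML.top
  | pre (a : Act) {φ : HML.{u, v} Act} : LogicT φ → LogicT (HML.pre a φ)

/-- Simulation formulas. -/
inductive LogicS : HML.{u, v} Act → Prop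
  | pre (a : Act) {φ : HML.{u, v} Act} : LogicS φ → LogicS (HML.pre a φ)
  | conj (ι : Type (max u v)) (φ : ι → HML.{u, v} Act) :
      (∀ i, LogicS (φ i)) → LogicS (HML.conj ι φ)

/-- The logic `L'_N` of the constraint `N`. -/
def constraintLogic : Constraint → Set (HML.{u, v} Act)
  | .U => {HML.top}
  | .C => {HML.top, HML.neg HML.zero}
  | .I => {HML.top, HML.neg HML.zero} ∪ {φ | ∃ a, φ = HML.pre a HML.top}
  | .T => {φ | LogicT φ}
  | .S => {φ | LogicS φ}

/-- The symmetric closure of `L'_N`. -/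
inductive SymClosure (N : Constraint) : HML.{u, v} Act → Prop
  | pos {σ : HML.{u, v} Act} : σ ∈ constraintLogic N → SymClosure N σ
  | neg {σ : HML.{u, v} Act} : σ ∈ constraintLogic N → SymClosure N (HML.neg σ)
  | conj (ι : Type (max u v)) (σ : ι → HML.{u, v} Act) :
      (∀ i, SymClosure N (σ i)) → SymClosure N (HML.conj ι σ)

/-- The negative closure of `L'_N`. -/
inductive NegClosure (N : Constraint) : HML.{u, v} Act → Prop
  | neg {σ : HML.{u, v} Act} : σ ∈ constraintLogic N → NegClosure N (HML.neg σ)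
  | conj (ι : Type (max u v)) (σ : ι → HML.{u, v} Act) :
      (∀ i, NegClosure N (σ i)) → NegClosure N (HML.conj ι σ)

/-- The logic of the `N`-constrained simulation semantics. -/
inductive LogicNS (N : Constraint) : HML.{u, v} Act → Prop
  | pos {σ : HML.{u, v} Act} : σ ∈ constraintLogic N → LogicNS N σ
  | neg {σ : HML.{u, v} Act} : σ ∈ constraintLogic N → LogicNS N (HML.neg σ)
  | conj (ι : Type (max u v)) (φ : ι → HML.{u, v} Act) :
      (∀ i, LogicNS N (φ i)) → LogicNS N (HML.conj ι φ)
  | pre (a : Act) {φ : HML.{u, v} Act} : LogicNS N φ → LogicNS N (HML.pre a φ)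

/-- The logic of the semantics `l` (ready traces when `N = I`). -/
inductive LogicL (N : Constraint) : HML.{u, v} Act → Prop
  | top : LogicL N HML.top
  | pre (a : Act) {φ : HML.{u, v} Act} : LogicL N φ → LogicL N (HML.pre a φ)
  | and {σ φ : HML.{u, v} Act} : SymClosure N σ → LogicL N φ → LogicL N (HML.and σ φ)

/-- The logic of the semantics `l⊇` (failure traces when `N = I`). -/
inductive LogicLSup (N : Constraint) : HML.{u, v} Act → Prop
  | top : LogicLSup N HML.top
  | pre (a : Act) {φ : HML.{u, v} Act} : LogicLSup N φ → LogicLSup N (HML.pre a φ)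
  | and {σ φ : HML.{u, v} Act} : NegClosure N σ → LogicLSup N φ → LogicLSup N (HML.and σ φ)

/-- The logic of the semantics `lf` (readiness when `N = I`). -/
inductive LogicLf (N : Constraint) : HML.{u, v} Act → Prop
  | top : LogicLf N HML.top
  | pre (a : Act) {φ : HML.{u, v} Act} : LogicLf N φ → LogicLf N (HML.pre a φ)
  | final {σ : HML.{u, v} Act} : SymClosure N σ → LogicLf N σ

/-- The logic of the semantics `lf⊇` (failures when `N = I`). -/
inductive LogicLfSup (N : Constraint) : HML.{u, v} Act → Prop
  | top : LogicLfSup N HML.top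
  | pre (a : Act) {φ : HML.{u, v} Act} : LogicLfSup N φ → LogicLfSup N (HML.pre a φ)
  | final {σ : HML.{u, v} Act} : NegClosure N σ → LogicLfSup N σ

/-- The logic of the deterministic branching semantics (possible worlds when `N = I`). -/
inductive LogicD (N : Constraint) : HML.{u, v} Act → Prop
  | top : LogicD N HML.top
  | and {σ φ : HML.{u, v} Act} : SymClosure N σ → LogicD N φ → LogicD N (HML.and σ φ)
  | conjPre (X : Set Act) (φ : X → HML.{u, v} Act) :
      (∀ a, LogicD N (φ a)) → LogicD N (HML.conjPre X φ)

/-- The unified logic of the semantics `Y` at the layer of the constraint `N`. -/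
def unifiedLogic (N : Constraint) : Sem → Set (HML.{u, v} Act)
  | .NS => {φ | LogicNS N φ}
  | .l => {φ | LogicL N φ}
  | .lsup => {φ | LogicLSup N φ}
  | .lf => {φ | LogicLf N φ}
  | .lfsup => {φ | LogicLfSup N φ}
  | .D => {φ | LogicD N φ}

end Logics

/-! ### Local observations -/

section Local

variable {Proc : Type w} {Act : Type u}

/-- The set `L_N` of local observations: a one-point set, the booleans, the sets of actions, the
sets of words over `Act`, the simulation equivalence classes. -/
inductive LocalObs (lts : LTS Proc Act) : Constraint → Type (max u w)
  | unit : LocalObs lts .U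
  | terminated (b : Bool) : LocalObs lts .C
  | offers (X : Set Act) : LocalObs lts .I
  | traces (X : Set (List Act)) : LocalObs lts .T
  | simClass (X : lts.SimClass) : LocalObs lts .S

open Classical in
/-- The local observation `L_N(p)` of the process `p`. -/
noncomputable def localObs (lts : LTS Proc Act) : (N : Constraint) → Proc → LocalObs lts N
  | .U, _ => .unit
  | .C, p => .terminated (decide (∀ a p', ¬ lts.Tr p a p'))
  | .I, p => .offers (lts.initials p)
  | .T, p => .traces (lts.traces p)
  | .S, p => .simClass (lts.simClass p)

/-- The order `X ⊇ Y` on local observations. For sets it is inclusion. In the other cases it says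
that a process with observation `Y` lies below one with observation `X` in the preorder of the
constraint: for `C`, if `X` is the observation of terminated processes then so is `Y`; for `S`,
the class `Y` is below `X` in the simulation preorder. -/
def LocalObs.Sup {lts : LTS Proc Act} : {N : Constraint} → LocalObs lts N → LocalObs lts N → Prop
  | _, .unit, .unit => True
  | _, .terminated b, .terminated c => b = true → c = true
  | _, .offers X, .offers Y => Y ⊆ X
  | _, .traces X, .traces Y => Y ⊆ X
  | _, .simClass X, .simClass Y => LTS.SimClass.le Y X

end Local

/-! ### Branching general observations

These are the finite trees whose nodes carry labels from `L` and whose arcs carry labels from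
`Act`, where the arcs that leave a node form a finite set of pairs of an action and a subtree. Such
trees are obtained from trees with ordered families of arcs by identifying two of them when they
recursively have the same sets of arcs. -/

section Trees

/-- Finite labelled trees with ordered families of arcs. -/
inductive PreTree (Act : Type u) (L : Type w) : Type (max u w)
  | node (l : L) (n : ℕ) (a : Fin n → Act) (t : Fin n → PreTree Act L) : PreTree Act L

variable {Act : Type u} {L : Type w}

/-- Two trees are equivalent if they have the same root label and, up to equivalence of the
subtrees, the same set of arcs. -/
def PreTree.Equiv : PreTree Act L → PreTree Act L → Prop
  | .node l n a t, .node l' n' a' t' =>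
      l = l' ∧ (∀ i : Fin n, ∃ j : Fin n', a i = a' j ∧ PreTree.Equiv (t i) (t' j)) ∧
        (∀ j : Fin n', ∃ i : Fin n, a i = a' j ∧ PreTree.Equiv (t i) (t' j))

theorem PreTree.Equiv.refl (x : PreTree Act L) : PreTree.Equiv x x := by
  induction x with
  | node l n a t ih => exact ⟨rfl, fun i => ⟨i, rfl, ih i⟩, fun i => ⟨i, rfl, ih i⟩⟩

theorem PreTree.Equiv.symm {x y : PreTree Act L} (h : PreTree.Equiv x y) :
    PreTree.Equiv y x := by
  induction x generalizing y with
  | node l n a t ih =>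
    cases y with
    | node l' n' a' t' =>
      obtain ⟨h₁, h₂, h₃⟩ := h
      refine ⟨h₁.symm, fun j => ?_, fun i => ?_⟩
      · obtain ⟨i, hi, hi'⟩ := h₃ j
        exact ⟨i, hi.symm, ih i hi'⟩
      · obtain ⟨j, hj, hj'⟩ := h₂ i
        exact ⟨j, hj.symm, ih i hj'⟩

theorem PreTree.Equiv.trans {x y z : PreTree Act L} (h : PreTree.Equiv x y)
    (k : PreTree.Equiv y z) : PreTree.Equiv x z := by
  induction x generalizing y z with
  | node l n a t ih =>
    cases y with
    | node l' n' a' t' =>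
      cases z with
      | node l'' n'' a'' t'' =>
        obtain ⟨h₁, h₂, h₃⟩ := h
        obtain ⟨k₁, k₂, k₃⟩ := k
        refine ⟨h₁.trans k₁, fun i => ?_, fun m => ?_⟩
        · obtain ⟨j, hj, hj'⟩ := h₂ i
          obtain ⟨m, hm, hm'⟩ := k₂ j
          exact ⟨m, hj.trans hm, ih i hj' hm'⟩
        · obtain ⟨j, hj, hj'⟩ := k₃ m
          obtain ⟨i, hi, hi'⟩ := h₃ j
          exact ⟨i, hi.trans hj, ih i hi' hj'⟩

/-- The equivalence of trees as a setoid. -/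
def PreTree.setoid (Act : Type u) (L : Type w) : Setoid (PreTree Act L) where
  r := PreTree.Equiv
  iseqv := ⟨PreTree.Equiv.refl, PreTree.Equiv.symm, PreTree.Equiv.trans⟩

/-- Finite trees with node labels in `L`, arc labels in `Act` and finite sets of arcs. -/
def Tree (Act : Type u) (L : Type w) : Type (max u w) := Quotient (PreTree.setoid Act L)

/-- The tree `⟨l, S⟩` with root label `l` and set of arcs `S`. -/
noncomputable def Tree.node (l : L) (S : Finset (Act × Tree Act L)) : Tree Act L :=
  Quotient.mk (PreTree.setoid Act L)
    (.node l S.card (fun i => (S.equivFin.symm i).1.1) (fun i => (S.equivFin.symm i).1.2.out))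

/-- A tree is determined by, and determines, its root label and its set of arcs. -/
theorem Tree.node_inj {l l' : L} {S S' : Finset (Act × Tree Act L)} :
    Tree.node l S = Tree.node l' S' ↔ l = l' ∧ S = S' := by
  have aux : ∀ {S S' : Finset (Act × Tree Act L)},
      (∀ i : Fin S.card, ∃ j : Fin S'.card, (S.equivFin.symm i).1.1 = (S'.equivFin.symm j).1.1 ∧
        PreTree.Equiv (S.equivFin.symm i).1.2.out (S'.equivFin.symm j).1.2.out) →
      ∀ x ∈ S, x ∈ S' := by
    intro S S' h x hx
    obtain ⟨j, hj, hj'⟩ := h (S.equivFin ⟨x, hx⟩)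
    simp only [Equiv.symm_apply_apply] at hj hj'
    have hout : x.2 = (S'.equivFin.symm j).1.2 := by
      rw [← Quotient.out_eq x.2, ← Quotient.out_eq (S'.equivFin.symm j).1.2]
      exact Quotient.sound hj'
    have hx' : x = (S'.equivFin.symm j).1 := Prod.ext hj hout
    rw [hx']
    exact (S'.equivFin.symm j).2
  constructor
  · intro h
    obtain ⟨h₁, h₂, h₃⟩ := Quotient.exact h
    refine ⟨h₁, Finset.ext fun x => ⟨aux h₂ x, aux (fun j => ?_) x⟩⟩
    obtain ⟨i, hi, hi'⟩ := h₃ j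
    exact ⟨i, hi.symm, hi'.symm⟩
  · rintro ⟨rfl, rfl⟩
    rfl

/-- Every tree is built from its subtrees, in finitely many steps. -/
theorem Tree.induction {P : Tree Act L → Prop}
    (h : ∀ l S, (∀ x ∈ S, P x.2) → P (Tree.node l S)) (θ : Tree Act L) : P θ := by
  classical
  refine Quotient.inductionOn (s := PreTree.setoid Act L) θ fun x => ?_
  induction x with
  | node l n a t ih =>
    let f : Fin n → Act × Tree Act L := fun i => (a i, Quotient.mk (PreTree.setoid Act L) (t i))
    have key : Tree.node l (Finset.univ.image f) =
        Quotient.mk (PreTree.setoid Act L) (.node l n a t) := by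
      refine Quotient.sound ⟨rfl, fun i => ?_, fun i => ?_⟩
      · obtain ⟨j, -, hj⟩ :=
          Finset.mem_image.1 ((Finset.univ.image f).equivFin.symm i).2
        refine ⟨j, (congrArg Prod.fst hj).symm, ?_⟩
        exact Quotient.exact (s := PreTree.setoid Act L)
          ((Quotient.out_eq _).trans (congrArg Prod.snd hj).symm)
      · have hi : f i ∈ Finset.univ.image f := Finset.mem_image_of_mem f (Finset.mem_univ i)
        refine ⟨(Finset.univ.image f).equivFin ⟨f i, hi⟩, ?_, ?_⟩
        · simp only [Equiv.symm_apply_apply]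
          rfl
        · simp only [Equiv.symm_apply_apply]
          exact Quotient.exact (s := PreTree.setoid Act L) (Quotient.out_eq _)
    rw [← key]
    refine h _ _ fun x hx => ?_
    obtain ⟨i, -, rfl⟩ := Finset.mem_image.1 hx
    exact ih i

/-- Linear trees: `⟨l, ∅⟩`, and `⟨l, {(a, θ)}⟩` for a linear tree `θ`. The linear tree
`⟨X₀, {(a₁, ⟨X₁, {(a₂, … ⟨Xₙ, ∅⟩ …)}⟩)}⟩` is written `X₀ a₁ X₁ … aₙ Xₙ`. -/
inductive Tree.IsLinear : Tree Act L → Prop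
  | nil (l : L) : Tree.IsLinear (Tree.node l ∅)
  | cons (l : L) (a : Act) {θ : Tree Act L} :
      Tree.IsLinear θ → Tree.IsLinear (Tree.node l {(a, θ)})

/-- Deterministic trees: the arcs that leave a node have pairwise different actions. -/
inductive Tree.IsDeterministic : Tree Act L → Prop
  | node (l : L) (S : Finset (Act × Tree Act L)) :
      (∀ x ∈ S, ∀ y ∈ S, x.1 = y.1 → x = y) → (∀ x ∈ S, Tree.IsDeterministic x.2) →
      Tree.IsDeterministic (Tree.node l S)

/-- `LinearMatch R Q` relates the linear trees `X₀ a₁ X₁ … aₙ Xₙ` and `Y₀ a₁ Y₁ … aₙ Yₙ` (with the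
same actions) if `R Xᵢ Yᵢ` for all `i < n` and `Q Xₙ Yₙ`. -/
inductive Tree.LinearMatch (R Q : L → L → Prop) : Tree Act L → Tree Act L → Prop
  | nil {l l' : L} : Q l l' → Tree.LinearMatch R Q (Tree.node l ∅) (Tree.node l' ∅)
  | cons {l l' : L} (a : Act) {θ θ' : Tree Act L} :
      R l l' → Tree.LinearMatch R Q θ θ' →
      Tree.LinearMatch R Q (Tree.node l {(a, θ)}) (Tree.node l' {(a, θ')})

end Trees

/-! ### Observational semantics -/

section Observations

variable {Proc : Type w} {Act : Type u}

/-- The set `BGO_N` of branching general observations. -/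
abbrev BGO (lts : LTS Proc Act) (N : Constraint) : Type (max u w) := Tree Act (LocalObs lts N)

/-- `IsBGO lts N p θ`: `θ = ⟨L_N(p), S⟩` where each element of `S` is a pair `(a, θ')` such that
`θ'` is an observation of some `p'` with a transition labelled `a` from `p` to `p'`. The function
`f` picks such a `p'` for each element of `S`. -/
inductive IsBGO (lts : LTS Proc Act) (N : Constraint) : Proc → BGO lts N → Prop
  | node (p : Proc) (S : Finset (Act × BGO lts N)) (f : Act × BGO lts N → Proc) :
      (∀ x ∈ S, lts.Tr p x.1 (f x)) → (∀ x ∈ S, IsBGO lts N (f x) x.2) →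
      IsBGO lts N p (Tree.node (localObs lts N p) S)

theorem isBGO_node_iff {lts : LTS Proc Act} {N : Constraint} {p : Proc} {l : LocalObs lts N}
    {S : Finset (Act × BGO lts N)} :
    IsBGO lts N p (Tree.node l S) ↔
      l = localObs lts N p ∧ ∀ x ∈ S, ∃ p', lts.Tr p x.1 p' ∧ IsBGO lts N p' x.2 := by
  classical
  constructor
  · intro h
    generalize hθ : Tree.node l S = θ at h
    cases h with
    | node _ T f h₁ h₂ =>
      obtain ⟨rfl, rfl⟩ := Tree.node_inj.1 hθ
      exact ⟨rfl, fun x hx => ⟨f x, h₁ x hx, h₂ x hx⟩⟩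
  · rintro ⟨rfl, h⟩
    refine IsBGO.node p S (fun x => if hx : x ∈ S then (h x hx).choose else p) ?_ ?_
    · intro x hx
      simp only [dif_pos hx]
      exact (h x hx).choose_spec.1
    · intro x hx
      simp only [dif_pos hx]
      exact (h x hx).choose_spec.2

/-- The set `BGO_N(p)` of branching general observations of `p`. -/
def bgo (lts : LTS Proc Act) (N : Constraint) (p : Proc) : Set (BGO lts N) :=
  {θ | IsBGO lts N p θ}

/-- The set `LGO_N(p)` of linear general observations of `p`. -/
def lgo (lts : LTS Proc Act) (N : Constraint) (p : Proc) : Set (BGO lts N) :=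
  bgo lts N p ∩ {θ | θ.IsLinear}

/-- The set `dBGO_N(p)` of deterministic branching general observations of `p`. -/
def dbgo (lts : LTS Proc Act) (N : Constraint) (p : Proc) : Set (BGO lts N) :=
  bgo lts N p ∩ {θ | θ.IsDeterministic}

/-- Every linear observation in `ζ` is matched by one in `ζ'`, with `R` at the intermediate states
and `Q` at the final state. -/
def LinearLE {lts : LTS Proc Act} {N : Constraint}
    (R Q : LocalObs lts N → LocalObs lts N → Prop) (ζ ζ' : Set (BGO lts N)) : Prop :=
  ∀ θ ∈ ζ, ∃ θ' ∈ ζ', Tree.LinearMatch R Q θ θ'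

/-- The observational preorder of the semantics `Y` at the layer of the constraint `N`. -/
def ObsLE (lts : LTS Proc Act) (N : Constraint) (Y : Sem) (p q : Proc) : Prop :=
  match Y with
  | .NS => bgo lts N p ⊆ bgo lts N q
  | .l => lgo lts N p ⊆ lgo lts N q
  | .lsup => LinearLE LocalObs.Sup LocalObs.Sup (lgo lts N p) (lgo lts N q)
  | .lf => LinearLE (fun _ _ => True) (fun X Y => X = Y) (lgo lts N p) (lgo lts N q)
  | .lfsup => LinearLE (fun _ _ => True) LocalObs.Sup (lgo lts N p) (lgo lts N q)
  | .D => dbgo lts N p ⊆ dbgo lts N q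

end Observations

end ProcessSemantics

namespace ProcessSemantics

/-! ### Constraint formulas and local observations -/

section LocalObservations

variable {Proc : Type w} {Act : Type u} {lts : LTS Proc Act}

/-! The argument separates what can be said about one state from how states are chained together.

At one state, formulas of `NegClosure N` express exactly the relation `⊇` between local
observations, and those of `SymClosure N` exactly equality. `Expresses` records both halves: the
formulas are preserved along the relation, and each image-finite process has a formula
characterising the processes related to it. Only for simulation does this need a Hennessy-Milner
argument (`sim_of_finSim`).

From observations to formulas, every tree is transcribed: each node becomes its characteristic
formula, each arc a prefix. Hence inclusion in the logical preorder gives inclusion of observations.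

From formulas to observations, a linear formula true at `p` is witnessed by a single path of `p`,
hence by one linear observation. Branching formulas may contain infinite conjunctions, which no
finite tree captures, so image-finiteness has to supply compactness. For `NS`, inclusion of
observations is itself transferred to successors, since finitely many observations of one state can
be united into one tree (`exists_bgo_subset`). A union may destroy determinism, so for `D` a formula
is witnessed by a set of deterministic observations in which any two elements are implied by a third
(`LogicD.exists_mergeable`). Such a set cannot be spread over finitely many successors: one of them
has all of it (`Mergeable.exists_subset_bgo`). -/

theorem LTS.ImageFinite.step {p p' : Proc} {a : Act} (h : lts.ImageFinite p)
    (ht : lts.Tr p a p') : lts.ImageFinite p' :=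
  fun r hr b => h r (Relation.ReflTransGen.head ⟨a, ht⟩ hr) b

theorem LTS.ImageFinite.finite {p : Proc} (h : lts.ImageFinite p) (a : Act) :
    {p' | lts.Tr p a p'}.Finite :=
  h p Relation.ReflTransGen.refl a

theorem HML.sat_top (p : Proc) : HML.Sat lts p (HML.top : HML.{u, v} Act) :=
  fun i => i.elim

theorem HML.sat_and {p : Proc} {φ ψ : HML.{u, v} Act} :
    HML.Sat lts p (HML.and φ ψ) ↔ HML.Sat lts p φ ∧ HML.Sat lts p ψ := by
  constructor
  · intro h
    exact ⟨h ⟨true⟩, h ⟨false⟩⟩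
  · rintro ⟨h, k⟩ ⟨b⟩
    cases b
    · exact k
    · exact h

theorem HML.sat_conjPre {p : Proc} {X : Set Act} {φ : X → HML.{u, v} Act} :
    HML.Sat lts p (HML.conjPre X φ) ↔ ∀ a : X, ∃ p', lts.Tr p a p' ∧ HML.Sat lts p' (φ a) :=
  ⟨fun h a => h ⟨a⟩, fun h a => h a.down⟩

theorem HML.sat_zero {p : Proc} :
    HML.Sat lts p (HML.zero : HML.{u, v} Act) ↔ ∀ a p', ¬ lts.Tr p a p' :=
  ⟨fun h a p' ht => h ⟨a⟩ ⟨p', ht, HML.sat_top p'⟩, fun h a ⟨p', ht, _⟩ => h a.down p' ht⟩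

/-- The trace formula of a word. -/
def HML.word : List Act → HML.{u, v} Act
  | [] => HML.top
  | a :: s => HML.pre a (HML.word s)

theorem HML.sat_word {s : List Act} {p : Proc} :
    HML.Sat lts p (HML.word s : HML.{u, v} Act) ↔ s ∈ lts.traces p := by
  induction s generalizing p with
  | nil => exact ⟨fun _ => ⟨p, .nil p⟩, fun _ => HML.sat_top p⟩
  | cons a s ih =>
    constructor
    · rintro ⟨p', ht, hs⟩
      obtain ⟨r, hr⟩ := ih.1 hs
      exact ⟨r, .cons ht hr⟩
    · rintro ⟨r, hr⟩
      cases hr with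
      | cons ht hr => exact ⟨_, ht, ih.2 ⟨r, hr⟩⟩

theorem logicT_iff {φ : HML.{u, v} Act} : LogicT φ ↔ ∃ s, φ = HML.word s := by
  constructor
  · intro h
    induction h with
    | top => exact ⟨[], rfl⟩
    | pre a _ ih =>
      obtain ⟨s, rfl⟩ := ih
      exact ⟨a :: s, rfl⟩
  · rintro ⟨s, rfl⟩
    induction s with
    | nil => exact .top
    | cons a s ih => exact .pre a ih

theorem LTS.Sim.step {p q p' : Proc} {a : Act} (h : lts.Sim p q) (ht : lts.Tr p a p') :
    ∃ q', lts.Tr q a q' ∧ lts.Sim p' q' := by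
  obtain ⟨S, hS, hpq⟩ := h
  obtain ⟨q', hq, hS'⟩ := hS p q hpq a p' ht
  exact ⟨q', hq, S, hS, hS'⟩

theorem LogicS.sat_of_sim {φ : HML.{u, v} Act} (hφ : LogicS φ) {p q : Proc} (h : lts.Sim p q)
    (hp : HML.Sat lts p φ) : HML.Sat lts q φ := by
  induction hφ generalizing p q with
  | pre a _ ih =>
    obtain ⟨p', ht, hs⟩ := hp
    obtain ⟨q', hq, hsim⟩ := h.step ht
    exact ⟨q', hq, ih hsim hs⟩
  | conj ι φ _ ih => exact fun i => ih i h (hp i)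

/-- Finitary simulation formulas. -/
inductive FinSim (Act : Type u) : Type u
  | conj (n : ℕ) (φ : Fin n → FinSim Act) : FinSim Act
  | pre (a : Act) (φ : FinSim Act) : FinSim Act

/-- A finitary simulation formula as a formula of Hennessy-Milner logic. -/
def FinSim.toHML : FinSim Act → HML.{u, v} Act
  | conj n φ => HML.conj (ULift (Fin n)) (fun i => (φ i.down).toHML)
  | pre a φ => HML.pre a φ.toHML

theorem FinSim.logicS (φ : FinSim Act) : LogicS (φ.toHML : HML.{u, v} Act) := by
  induction φ with
  | conj n φ ih => exact .conj _ _ fun i => ih i.down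
  | pre a φ ih => exact .pre a ih

/-- Hennessy-Milner argument: if no `a`-successor of `y` matched `x'`, each would fail some formula
true at `x'`. There are finitely many of them, so the conjunction of these formulas, prefixed by
`a`, is a finitary formula that holds at `x` and fails at `y`. -/
theorem sim_of_finSim {p q : Proc} (hq : lts.ImageFinite q)
    (h : ∀ φ : FinSim Act, HML.Sat lts p (φ.toHML : HML.{u, v} Act) →
      HML.Sat lts q (φ.toHML : HML.{u, v} Act)) : lts.Sim p q := by
  refine ⟨fun x y => lts.ImageFinite y ∧ ∀ φ : FinSim Act,
    HML.Sat lts x (φ.toHML : HML.{u, v} Act) → HML.Sat lts y (φ.toHML : HML.{u, v} Act),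
    ?_, hq, h⟩
  rintro x y ⟨hy, hxy⟩ a x' hx
  by_contra! hcon
  have hfin := hy.finite a
  have key : ∀ y' : {y' | lts.Tr y a y'}, ∃ φ : FinSim Act,
      HML.Sat lts x' (φ.toHML : HML.{u, v} Act) ∧
        ¬ HML.Sat lts y' (φ.toHML : HML.{u, v} Act) := by
    exact fun y' => hcon y' y'.2 (hy.step y'.2)
  choose φ hφ hφ' using key
  have := hfin.to_subtype
  obtain ⟨n, ⟨e⟩⟩ := Finite.exists_equiv_fin {y' | lts.Tr y a y'}
  obtain ⟨y', hy', hs⟩ := hxy (.pre a (.conj n fun i => φ (e.symm i)))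
    ⟨x', hx, fun i => hφ (e.symm i.down)⟩
  have hs' := hs ⟨e ⟨y', hy'⟩⟩
  simp only [Equiv.symm_apply_apply] at hs'
  exact hφ' ⟨y', hy'⟩ hs'

/-- Formulas of `L'_N` only assert that behaviour is present (`¬0` says that some transition
exists), so they pass from the smaller process to the larger one. Their negations pass the other
way. -/
theorem sat_of_localObs_sup {N : Constraint} {p q : Proc}
    (h : LocalObs.Sup (localObs lts N p) (localObs lts N q)) {σ : HML.{u, v} Act}
    (hσ : σ ∈ constraintLogic N) (hq : HML.Sat lts q σ) : HML.Sat lts p σ := by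
  have hzero : ((∀ a p', ¬ lts.Tr p a p') → ∀ a p', ¬ lts.Tr q a p') →
      HML.Sat lts q (HML.neg HML.zero : HML.{u, v} Act) →
      HML.Sat lts p (HML.neg HML.zero : HML.{u, v} Act) :=
    fun h k hp => k (HML.sat_zero.2 (h (HML.sat_zero.1 hp)))
  cases N with
  | U =>
    obtain rfl : σ = HML.top := hσ
    exact HML.sat_top p
  | C =>
    obtain rfl | rfl : σ = HML.top ∨ σ = HML.neg HML.zero := hσ
    · exact HML.sat_top p
    · exact hzero (by simpa [localObs, LocalObs.Sup] using h) hq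
  | I =>
    have h' : lts.initials q ⊆ lts.initials p := h
    obtain (rfl | rfl) | ⟨a, rfl⟩ :
      (σ = HML.top ∨ σ = HML.neg HML.zero) ∨ ∃ a, σ = HML.pre a HML.top := hσ
    · exact HML.sat_top p
    · refine hzero (fun hp a q' ht => ?_) hq
      obtain ⟨p', hp'⟩ := h' ⟨q', ht⟩
      exact hp a p' hp'
    · obtain ⟨q', ht, -⟩ := hq
      obtain ⟨p', hp'⟩ := h' ⟨q', ht⟩
      exact ⟨p', hp', HML.sat_top p'⟩
  | T =>
    have h' : lts.traces q ⊆ lts.traces p := h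
    obtain ⟨s, rfl⟩ := logicT_iff.1 hσ
    exact HML.sat_word.2 (h' (HML.sat_word.1 hq))
  | S =>
    have h' : lts.Sim q p := h
    exact LogicS.sat_of_sim hσ h' hq

/-- The local observations of image-finite processes are determined by a small family of
constraint formulas. -/
theorem exists_constraint_family (N : Constraint) :
    ∃ (ι : Type u) (σ : ι → HML.{u, v} Act), (∀ i, σ i ∈ constraintLogic N) ∧
      ∀ {Proc : Type w} (lts : LTS Proc Act) (p q : Proc), lts.ImageFinite p →
        (∀ i, HML.Sat lts q (σ i) → HML.Sat lts p (σ i)) →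
        LocalObs.Sup (localObs lts N p) (localObs lts N q) := by
  cases N with
  | U => exact ⟨PEmpty, fun i => i.elim, fun i => i.elim, fun _ _ _ _ _ => trivial⟩
  | C =>
    refine ⟨PUnit, fun _ => HML.neg HML.zero, fun _ => Or.inr rfl, fun lts p q _ h => ?_⟩
    have h' := h PUnit.unit
    have : (∀ a p', ¬ lts.Tr p a p') → ∀ a p', ¬ lts.Tr q a p' := by
      intro hp
      by_contra hcon
      exact h' (fun hz => hcon (HML.sat_zero.1 hz)) (HML.sat_zero.2 hp)
    simpa [localObs, LocalObs.Sup] using this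
  | I =>
    refine ⟨Act, fun a => HML.pre a HML.top, fun a => Or.inr ⟨a, rfl⟩, fun lts p q _ h => ?_⟩
    rintro a ⟨q', ht⟩
    obtain ⟨p', hp', -⟩ := h a ⟨q', ht, HML.sat_top q'⟩
    exact ⟨p', hp'⟩
  | T =>
    exact ⟨List Act, HML.word, fun s => logicT_iff.2 ⟨s, rfl⟩,
      fun lts p q _ h s hs => HML.sat_word.1 (h s (HML.sat_word.2 hs))⟩
  | S =>
    -- Arbitrary simulation formulas are too many to index a conjunction within the given universe;
    -- the finitary ones form a type in the universe of `Act`.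
    exact ⟨FinSim Act, FinSim.toHML, FinSim.logicS, fun lts p q hp h => sim_of_finSim hp h⟩

/-- Antisymmetry of `⊇`, by which equality of observations reduces to two uses of the one-sided
results. -/
theorem localObs_eq_iff {N : Constraint} {p q : Proc} :
    localObs lts N p = localObs lts N q ↔
      LocalObs.Sup (localObs lts N p) (localObs lts N q) ∧
        LocalObs.Sup (localObs lts N q) (localObs lts N p) := by
  constructor
  · intro h
    have hrefl : ∀ r, LocalObs.Sup (localObs lts N r) (localObs lts N r) := by
      intro r
      cases N with
      | U => trivial
      | C => exact id
      | I => exact subset_rfl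
      | T => exact subset_rfl
      | S => exact LTS.Sim.refl lts r
    rw [h]
    exact ⟨hrefl q, hrefl q⟩
  · rintro ⟨h, k⟩
    cases N with
    | U => rfl
    | C => exact congrArg LocalObs.terminated (Bool.eq_iff_iff.2 ⟨h, k⟩)
    | I => exact congrArg LocalObs.offers (subset_antisymm k h)
    | T => exact congrArg LocalObs.traces (subset_antisymm k h)
    | S => exact congrArg LocalObs.simClass (Quotient.sound ⟨k, h⟩)

/-- The formulas in `K` express the relation `R` to the local observation of a process. -/
structure Expresses (lts : LTS Proc Act) (N : Constraint) (K : HML.{u, v} Act → Prop)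
    (R : LocalObs lts N → LocalObs lts N → Prop) : Prop where
  sound {p q : Proc} {σ : HML.{u, v} Act} : R (localObs lts N p) (localObs lts N q) → K σ →
    HML.Sat lts p σ → HML.Sat lts q σ
  exists_char {p : Proc} : lts.ImageFinite p → ∃ σ, K σ ∧ HML.Sat lts p σ ∧
    ∀ q, lts.ImageFinite q → HML.Sat lts q σ → R (localObs lts N p) (localObs lts N q)

theorem negClosure_expresses (lts : LTS Proc Act) (N : Constraint) :
    Expresses lts N (NegClosure.{u, v} N) LocalObs.Sup where
  sound := by
    intro p q σ h hσ hp
    induction hσ with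
    | neg hσ => exact fun hq => hp (sat_of_localObs_sup h hσ hq)
    | conj ι σ _ ih => exact fun i => ih i (hp i)
  exists_char := by
    intro p hp
    obtain ⟨ι, σ, hσ, hfam⟩ := exists_constraint_family.{u, v, w} (Act := Act) N
    -- The characteristic formula denies every member of the family that fails at `p`, so whatever
    -- member holds at `q` must hold at `p`.
    refine ⟨HML.conj (ULift {i // ¬ HML.Sat lts p (σ i)}) (fun i => HML.neg (σ i.down.1)),
      .conj _ _ fun i => .neg (hσ i.down.1), fun i => i.down.2, fun q _ hs => ?_⟩
    refine hfam lts p q hp fun i hi => ?_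
    by_contra hcon
    exact hs ⟨⟨i, hcon⟩⟩ hi

theorem symClosure_expresses (lts : LTS Proc Act) (N : Constraint) :
    Expresses lts N (SymClosure.{u, v} N) (fun X Y => X = Y) where
  sound := by
    intro p q σ h hσ hp
    obtain ⟨h₁, h₂⟩ := localObs_eq_iff.1 h
    induction hσ with
    | pos hσ => exact sat_of_localObs_sup h₂ hσ hp
    | neg hσ => exact fun hq => hp (sat_of_localObs_sup h₁ hσ hq)
    | conj ι σ _ ih => exact fun i => ih i (hp i)
  exists_char := by
    intro p hp
    obtain ⟨ι, σ, hσ, hfam⟩ := exists_constraint_family.{u, v, w} (Act := Act) N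
    -- The left summand denies the members failing at `p`, the right one asserts those holding at
    -- `p`; they give the two inclusions.
    refine ⟨HML.conj (ULift ({i // ¬ HML.Sat lts p (σ i)} ⊕ {i // HML.Sat lts p (σ i)}))
      (fun i => i.down.elim (fun i => HML.neg (σ i.1)) (fun i => σ i.1)), .conj _ _ ?_, ?_, ?_⟩
    · rintro ⟨i | i⟩
      · exact .neg (hσ i.1)
      · exact .pos (hσ i.1)
    · rintro ⟨i | i⟩
      · exact i.2
      · exact i.2
    · intro q hq hs
      refine localObs_eq_iff.2 ⟨hfam lts p q hp fun i hi => ?_,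
        hfam lts q p hq fun i hi => hs ⟨.inr ⟨i, hi⟩⟩⟩
      by_contra hcon
      exact hs ⟨.inl ⟨i, hcon⟩⟩ hi

end LocalObservations

/-! ### Linear semantics -/

section Linear

variable {Proc : Type w} {Act : Type u} {lts : LTS Proc Act} {N : Constraint}

theorem isBGO_empty {p : Proc} {l : LocalObs lts N} :
    IsBGO lts N p (Tree.node l ∅) ↔ l = localObs lts N p := by
  simp [isBGO_node_iff]

theorem isBGO_singleton {p : Proc} {l : LocalObs lts N} {a : Act} {θ : BGO lts N} :
    IsBGO lts N p (Tree.node l {(a, θ)}) ↔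
      l = localObs lts N p ∧ ∃ p', lts.Tr p a p' ∧ IsBGO lts N p' θ := by
  simp [isBGO_node_iff]

theorem IsBGO.exists_eq_node {p : Proc} {θ : BGO lts N} (h : IsBGO lts N p θ) :
    ∃ S, θ = Tree.node (localObs lts N p) S := by
  cases h with
  | node _ S f _ _ => exact ⟨S, rfl⟩

theorem Tree.node_empty_ne_singleton {L : Type w} {l l' : L} {a : Act} {θ : Tree Act L} :
    Tree.node l ∅ ≠ Tree.node l' {(a, θ)} :=
  fun h => Finset.singleton_ne_empty _ (Tree.node_inj.1 h).2.symm

theorem Tree.linearMatch_nil_inv {L : Type w} {R Q : L → L → Prop} {l : L} {θ : Tree Act L}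
    (h : Tree.LinearMatch R Q (Tree.node l ∅) θ) : ∃ l', Q l l' ∧ θ = Tree.node l' ∅ := by
  generalize hx : Tree.node l ∅ = x at h
  cases h with
  | nil hQ =>
    obtain ⟨rfl, -⟩ := Tree.node_inj.1 hx
    exact ⟨_, hQ, rfl⟩
  | cons a hR hm => exact absurd hx Tree.node_empty_ne_singleton

theorem Tree.linearMatch_cons_inv {L : Type w} {R Q : L → L → Prop} {l : L} {a : Act}
    {θ x : Tree Act L} (h : Tree.LinearMatch R Q (Tree.node l {(a, θ)}) x) :
    ∃ l' θ', R l l' ∧ Tree.LinearMatch R Q θ θ' ∧ x = Tree.node l' {(a, θ')} := by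
  generalize hy : Tree.node l {(a, θ)} = y at h
  cases h with
  | nil hQ => exact absurd hy.symm Tree.node_empty_ne_singleton
  | cons b hR hm =>
    obtain ⟨rfl, hs⟩ := Tree.node_inj.1 hy
    obtain ⟨rfl, rfl⟩ := Prod.mk.inj (Finset.singleton_inj.1 hs)
    exact ⟨_, _, hR, hm, rfl⟩

/-- Makes the inclusion that defines `l` the instance `R = Q = (=)` of linear matching, so that `l`
and `l⊇` share one proof. -/
theorem Tree.linearMatch_eq_iff {L : Type w} {θ θ' : Tree Act L} :
    Tree.LinearMatch (fun X Y => X = Y) (fun X Y => X = Y) θ θ' ↔ θ.IsLinear ∧ θ = θ' := by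
  constructor
  · intro h
    induction h with
    | nil h => exact ⟨.nil _, by rw [h]⟩
    | cons a h _ ih => exact ⟨.cons _ a ih.1, by rw [h, ih.2]⟩
  · rintro ⟨h, rfl⟩
    induction h with
    | nil l => exact .nil rfl
    | cons l a _ ih => exact .cons a rfl ih

theorem nil_mem_lgo (p : Proc) : Tree.node (localObs lts N p) ∅ ∈ lgo lts N p :=
  ⟨isBGO_empty.2 rfl, .nil _⟩

theorem cons_mem_lgo {p p' : Proc} {a : Act} {θ : BGO lts N} (ht : lts.Tr p a p')
    (h : θ ∈ lgo lts N p') : Tree.node (localObs lts N p) {(a, θ)} ∈ lgo lts N p :=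
  ⟨isBGO_singleton.2 ⟨rfl, p', ht, h.1⟩, .cons _ a h.2⟩

theorem mem_lgo_of_cons {q : Proc} {l : LocalObs lts N} {a : Act} {θ : BGO lts N}
    (h : IsBGO lts N q (Tree.node l {(a, θ)}))
    (hlin : θ.IsLinear) : l = localObs lts N q ∧ ∃ q', lts.Tr q a q' ∧ θ ∈ lgo lts N q' := by
  obtain ⟨hl, q', hq', hθ⟩ := isBGO_singleton.1 h
  exact ⟨hl, q', hq', hθ, hlin⟩

theorem Tree.LinearMatch.isLinear_right {L : Type w} {R Q : L → L → Prop} {θ θ' : Tree Act L}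
    (h : Tree.LinearMatch R Q θ θ') : θ'.IsLinear := by
  induction h with
  | nil _ => exact .nil _
  | cons a _ _ ih => exact .cons _ a ih

/-! ### Chain formulas and final formulas versus linear observations -/

/-- The logic of chains of prefixes in which formulas of `K` may be asserted at every state. -/
inductive ChainLogic (K : HML.{u, v} Act → Prop) : HML.{u, v} Act → Prop
  | top : ChainLogic K HML.top
  | pre (a : Act) {φ : HML.{u, v} Act} : ChainLogic K φ → ChainLogic K (HML.pre a φ)
  | and {σ φ : HML.{u, v} Act} : K σ → ChainLogic K φ → ChainLogic K (HML.and σ φ)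

/-- The logic of chains of prefixes in which a formula of `K` may be asserted at the end. -/
inductive FinalLogic (K : HML.{u, v} Act → Prop) : HML.{u, v} Act → Prop
  | top : FinalLogic K HML.top
  | pre (a : Act) {φ : HML.{u, v} Act} : FinalLogic K φ → FinalLogic K (HML.pre a φ)
  | final {σ : HML.{u, v} Act} : K σ → FinalLogic K σ

variable {K : HML.{u, v} Act → Prop} {R : LocalObs lts N → LocalObs lts N → Prop}

/-- The path of `p` that makes the formula true, with its labels, is the required observation. A
conjunct `σ` adds no arc: it is transferred by the root label alone. -/
theorem ChainLogic.exists_lgo (hK : Expresses lts N K R) {φ : HML.{u, v} Act}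
    (hφ : ChainLogic K φ) {p : Proc} (hp : HML.Sat lts p φ) :
    ∃ θ ∈ lgo lts N p, ∀ q, ∀ θ' ∈ lgo lts N q, Tree.LinearMatch R R θ θ' →
      HML.Sat lts q φ := by
  induction hφ generalizing p with
  | top => exact ⟨_, nil_mem_lgo p, fun q _ _ _ => HML.sat_top q⟩
  | pre a _ ih =>
    obtain ⟨p', ht, hs⟩ := hp
    obtain ⟨θ, hθ, hθ'⟩ := ih hs
    refine ⟨_, cons_mem_lgo ht hθ, fun q x hx hm => ?_⟩
    obtain ⟨l', θ', -, hm', rfl⟩ := Tree.linearMatch_cons_inv hm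
    obtain ⟨-, q', hq', hmem⟩ := mem_lgo_of_cons hx.1 hm'.isLinear_right
    exact ⟨q', hq', hθ' q' θ' hmem hm'⟩
  | and hσ _ ih =>
    obtain ⟨hs, hs'⟩ := HML.sat_and.1 hp
    obtain ⟨θ, hθ, hθ'⟩ := ih hs'
    refine ⟨θ, hθ, fun q x hx hm => HML.sat_and.2 ⟨hK.sound ?_ hσ hs, hθ' q x hx hm⟩⟩
    obtain ⟨S, hS⟩ := hθ.1.exists_eq_node
    obtain ⟨S', hS'⟩ := hx.1.exists_eq_node
    -- Either way a match relates the root labels, which are the local observations of `p` and `q`.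
    cases hm with
    | nil h =>
      rw [← (Tree.node_inj.1 hS).1, ← (Tree.node_inj.1 hS').1]
      exact h
    | cons a h _ =>
      rw [← (Tree.node_inj.1 hS).1, ← (Tree.node_inj.1 hS').1]
      exact h

theorem exists_chainLogic (hK : Expresses lts N K R) {θ : BGO lts N} (hlin : θ.IsLinear)
    {p : Proc} (hp : lts.ImageFinite p) (hθ : IsBGO lts N p θ) :
    ∃ φ, ChainLogic K φ ∧ HML.Sat lts p φ ∧ ∀ q, lts.ImageFinite q → HML.Sat lts q φ →
      ∃ θ' ∈ lgo lts N q, Tree.LinearMatch R R θ θ' := by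
  induction hlin generalizing p with
  | nil l =>
    obtain rfl := isBGO_empty.1 hθ
    obtain ⟨σ, hσ, hps, hchar⟩ := hK.exists_char hp
    refine ⟨_, .and hσ .top, HML.sat_and.2 ⟨hps, HML.sat_top p⟩, fun q hq hs => ?_⟩
    exact ⟨_, nil_mem_lgo q, .nil (hchar q hq (HML.sat_and.1 hs).1)⟩
  | cons l a _ ih =>
    obtain ⟨rfl, p', ht, hθ'⟩ := isBGO_singleton.1 hθ
    obtain ⟨φ, hφ, hpφ, hφ'⟩ := ih (hp.step ht) hθ'
    obtain ⟨σ, hσ, hps, hchar⟩ := hK.exists_char hp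
    refine ⟨_, .and hσ (.pre a hφ), HML.sat_and.2 ⟨hps, p', ht, hpφ⟩, fun q hq hs => ?_⟩
    obtain ⟨hs₁, q', hq', hs₂⟩ := HML.sat_and.1 hs
    obtain ⟨θ', hmem, hm⟩ := hφ' q' (hq.step hq') hs₂
    exact ⟨_, cons_mem_lgo hq' hmem, .cons a (hchar q hq hs₁) hm⟩

theorem chainLogic_le_iff (hK : Expresses lts N K R) {p q : Proc} (hp : lts.ImageFinite p)
    (hq : lts.ImageFinite q) :
    LogicLE lts {φ | ChainLogic K φ} p q ↔ LinearLE R R (lgo lts N p) (lgo lts N q) := by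
  constructor
  · intro h θ hθ
    obtain ⟨φ, hφ, hpφ, hφ'⟩ := exists_chainLogic hK hθ.2 hp hθ.1
    exact hφ' q hq (h φ hφ hpφ)
  · intro h φ hφ hpφ
    obtain ⟨θ, hθ, hθ'⟩ := ChainLogic.exists_lgo hK hφ hpφ
    obtain ⟨x, hx, hm⟩ := h θ hθ
    exact hθ' q x hx hm

theorem FinalLogic.exists_lgo (hK : Expresses lts N K R) {φ : HML.{u, v} Act}
    (hφ : FinalLogic K φ) {p : Proc} (hp : HML.Sat lts p φ) :
    ∃ θ ∈ lgo lts N p, ∀ q, ∀ θ' ∈ lgo lts N q, Tree.LinearMatch (fun _ _ => True) R θ θ' →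
      HML.Sat lts q φ := by
  induction hφ generalizing p with
  | top => exact ⟨_, nil_mem_lgo p, fun q _ _ _ => HML.sat_top q⟩
  | pre a _ ih =>
    obtain ⟨p', ht, hs⟩ := hp
    obtain ⟨θ, hθ, hθ'⟩ := ih hs
    refine ⟨_, cons_mem_lgo ht hθ, fun q x hx hm => ?_⟩
    obtain ⟨l', θ', -, hm', rfl⟩ := Tree.linearMatch_cons_inv hm
    obtain ⟨-, q', hq', hmem⟩ := mem_lgo_of_cons hx.1 hm'.isLinear_right
    exact ⟨q', hq', hθ' q' θ' hmem hm'⟩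
  | final hσ =>
    -- The assertion `σ` is made where the path ends, so the one-node observation suffices.
    refine ⟨_, nil_mem_lgo p, fun q x hx hm => ?_⟩
    obtain ⟨l', hR, rfl⟩ := Tree.linearMatch_nil_inv hm
    obtain rfl := isBGO_empty.1 hx.1
    exact hK.sound hR hσ hp

theorem exists_finalLogic (hK : Expresses lts N K R) {θ : BGO lts N} (hlin : θ.IsLinear)
    {p : Proc} (hp : lts.ImageFinite p) (hθ : IsBGO lts N p θ) :
    ∃ φ, FinalLogic K φ ∧ HML.Sat lts p φ ∧ ∀ q, lts.ImageFinite q → HML.Sat lts q φ →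
      ∃ θ' ∈ lgo lts N q, Tree.LinearMatch (fun _ _ => True) R θ θ' := by
  induction hlin generalizing p with
  | nil l =>
    obtain rfl := isBGO_empty.1 hθ
    obtain ⟨σ, hσ, hps, hchar⟩ := hK.exists_char hp
    exact ⟨_, .final hσ, hps, fun q hq hs => ⟨_, nil_mem_lgo q, .nil (hchar q hq hs)⟩⟩
  | cons l a _ ih =>
    obtain ⟨rfl, p', ht, hθ'⟩ := isBGO_singleton.1 hθ
    obtain ⟨φ, hφ, hpφ, hφ'⟩ := ih (hp.step ht) hθ'
    refine ⟨_, .pre a hφ, ⟨p', ht, hpφ⟩, fun q hq hs => ?_⟩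
    obtain ⟨q', hq', hs'⟩ := hs
    obtain ⟨θ', hmem, hm⟩ := hφ' q' (hq.step hq') hs'
    exact ⟨_, cons_mem_lgo hq' hmem, .cons a trivial hm⟩

theorem finalLogic_le_iff (hK : Expresses lts N K R) {p q : Proc} (hp : lts.ImageFinite p)
    (hq : lts.ImageFinite q) :
    LogicLE lts {φ | FinalLogic K φ} p q ↔
      LinearLE (fun _ _ => True) R (lgo lts N p) (lgo lts N q) := by
  constructor
  · intro h θ hθ
    obtain ⟨φ, hφ, hpφ, hφ'⟩ := exists_finalLogic hK hθ.2 hp hθ.1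
    exact hφ' q hq (h φ hφ hpφ)
  · intro h φ hφ hpφ
    obtain ⟨θ, hθ, hθ'⟩ := FinalLogic.exists_lgo hK hφ hpφ
    obtain ⟨x, hx, hm⟩ := h θ hθ
    exact hθ' q x hx hm

theorem lgo_subset_iff {p q : Proc} :
    lgo lts N p ⊆ lgo lts N q ↔
      LinearLE (fun X Y => X = Y) (fun X Y => X = Y) (lgo lts N p) (lgo lts N q) := by
  constructor
  · intro h θ hθ
    exact ⟨θ, h hθ, Tree.linearMatch_eq_iff.2 ⟨hθ.2, rfl⟩⟩
  · intro h θ hθ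
    obtain ⟨θ', hmem, hm⟩ := h θ hθ
    rw [(Tree.linearMatch_eq_iff.1 hm).2]
    exact hmem

/-! ### The four linear logics as chain and final logics -/

theorem unifiedLogic_l (N : Constraint) :
    unifiedLogic.{u, v} (Act := Act) N .l = {φ | ChainLogic (SymClosure N) φ} := by
  ext φ
  constructor <;> intro h <;> induction h with
  | top => exact .top
  | pre a _ ih => exact .pre a ih
  | and hσ _ ih => exact .and hσ ih

theorem unifiedLogic_lsup (N : Constraint) :
    unifiedLogic.{u, v} (Act := Act) N .lsup = {φ | ChainLogic (NegClosure N) φ} := by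
  ext φ
  constructor <;> intro h <;> induction h with
  | top => exact .top
  | pre a _ ih => exact .pre a ih
  | and hσ _ ih => exact .and hσ ih

theorem unifiedLogic_lf (N : Constraint) :
    unifiedLogic.{u, v} (Act := Act) N .lf = {φ | FinalLogic (SymClosure N) φ} := by
  ext φ
  constructor <;> intro h <;> induction h with
  | top => exact .top
  | pre a _ ih => exact .pre a ih
  | final hσ => exact .final hσ

theorem unifiedLogic_lfsup (N : Constraint) :
    unifiedLogic.{u, v} (Act := Act) N .lfsup = {φ | FinalLogic (NegClosure N) φ} := by
  ext φ
  constructor <;> intro h <;> induction h with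
  | top => exact .top
  | pre a _ ih => exact .pre a ih
  | final hσ => exact .final hσ

end Linear

/-! ### Branching semantics -/

section Branching

variable {Proc : Type w} {Act : Type u} {lts : LTS Proc Act} {N : Constraint}

theorem SymClosure.logicNS {σ : HML.{u, v} Act} (h : SymClosure N σ) : LogicNS N σ := by
  induction h with
  | pos h => exact .pos h
  | neg h => exact .neg h
  | conj ι σ _ ih => exact .conj ι σ ih

theorem LogicNS.and {φ ψ : HML.{u, v} Act} (hφ : LogicNS N φ) (hψ : LogicNS N ψ) :
    LogicNS N (HML.and φ ψ) := by
  refine .conj _ _ ?_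
  rintro ⟨_ | _⟩
  · exact hψ
  · exact hφ

theorem exists_logicNS {θ : BGO lts N} {p : Proc} (hp : lts.ImageFinite p)
    (hθ : IsBGO lts N p θ) :
    ∃ φ : HML.{u, v} Act, LogicNS N φ ∧ HML.Sat lts p φ ∧
      ∀ q, lts.ImageFinite q → HML.Sat lts q φ → IsBGO lts N q θ := by
  induction hθ with
  | node p S f hf _ ih =>
    obtain ⟨σ, hσ, hps, hchar⟩ := (symClosure_expresses.{u, v, w} lts N).exists_char hp
    have key : ∀ x : S, ∃ φ : HML.{u, v} Act, LogicNS N φ ∧ HML.Sat lts (f x) φ ∧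
        ∀ q, lts.ImageFinite q → HML.Sat lts q φ → IsBGO lts N q x.1.2 :=
      fun x => ih x.1 x.2 (hp.step (hf x.1 x.2))
    choose φ hφ hpφ hφ' using key
    refine ⟨HML.and σ (HML.conj (ULift (Fin S.card)) fun i =>
      HML.pre (S.equivFin.symm i.down).1.1 (φ (S.equivFin.symm i.down))),
      hσ.logicNS.and (.conj _ _ fun i => .pre _ (hφ _)), HML.sat_and.2 ⟨hps, fun i => ?_⟩, ?_⟩
    · exact ⟨_, hf _ (S.equivFin.symm i.down).2, hpφ _⟩
    · intro q hq hs
      obtain ⟨hs₁, hs₂⟩ := HML.sat_and.1 hs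
      refine isBGO_node_iff.2 ⟨hchar q hq hs₁, fun x hx => ?_⟩
      obtain ⟨q', hq', hs'⟩ := hs₂ ⟨S.equivFin ⟨x, hx⟩⟩
      simp only [Equiv.symm_apply_apply] at hq' hs'
      exact ⟨q', hq', hφ' ⟨x, hx⟩ q' (hq.step hq') hs'⟩

/-- Otherwise each of the finitely many `a`-successors of `q` lacks some observation of `p'`. All
these have root label `L_N(p')`, so their arcs can be united into one observation of `p'`. Below an
`a`-arc it is an observation of `p`, hence of `q`; the successor of `q` that realises it then has,
by dropping arcs, the very observation it lacks. -/
theorem exists_bgo_subset {p q p' : Proc} {a : Act} (hq : lts.ImageFinite q)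
    (h : bgo lts N p ⊆ bgo lts N q) (ht : lts.Tr p a p') :
    ∃ q', lts.Tr q a q' ∧ bgo lts N p' ⊆ bgo lts N q' := by
  classical
  by_contra! hcon
  -- The choice covers all states; the default `∅` off the successors is harmless, as only
  -- successors enter the union.
  have key : ∀ q', ∃ S : Finset (Act × BGO lts N), lts.Tr q a q' →
      IsBGO lts N p' (Tree.node (localObs lts N p') S) ∧
        ¬ IsBGO lts N q' (Tree.node (localObs lts N p') S) := by
    intro q'
    by_cases hq' : lts.Tr q a q'
    · obtain ⟨θ, hθ, hθ'⟩ := Set.not_subset.1 (hcon q' hq')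
      obtain ⟨S, rfl⟩ := IsBGO.exists_eq_node hθ
      exact ⟨S, fun _ => ⟨hθ, hθ'⟩⟩
    · exact ⟨∅, fun h => absurd h hq'⟩
  choose S hS using key
  have hmem : IsBGO lts N p'
      (Tree.node (localObs lts N p') ((hq.finite a).toFinset.biUnion S)) := by
    refine isBGO_node_iff.2 ⟨rfl, fun x hx => ?_⟩
    obtain ⟨q', hq', hx⟩ := Finset.mem_biUnion.1 hx
    exact (isBGO_node_iff.1 (hS q' ((hq.finite a).mem_toFinset.1 hq')).1).2 x hx
  obtain ⟨-, q', hq', hθ⟩ := isBGO_singleton.1 (h (isBGO_singleton.2 ⟨rfl, p', ht, hmem⟩))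
  obtain ⟨hl, hθ⟩ := isBGO_node_iff.1 hθ
  exact (hS q' hq').2 (isBGO_node_iff.2 ⟨hl, fun x hx => hθ x
    (Finset.mem_biUnion.2 ⟨q', (hq.finite a).mem_toFinset.2 hq', hx⟩)⟩)

theorem LogicNS.sat_of_bgo_subset {φ : HML.{u, v} Act} (hφ : LogicNS N φ) {p q : Proc}
    (hq : lts.ImageFinite q) (h : bgo lts N p ⊆ bgo lts N q) (hp : HML.Sat lts p φ) :
    HML.Sat lts q φ := by
  have hobs : ∀ {p q : Proc}, bgo lts N p ⊆ bgo lts N q →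
      localObs lts N p = localObs lts N q :=
    -- The one-node observation of `p` already determines the label of `q`.
    fun h => isBGO_empty.1 (h (isBGO_empty.2 rfl))
  induction hφ generalizing p q with
  | pos hσ => exact (symClosure_expresses lts N).sound (hobs h) (.pos hσ) hp
  | neg hσ => exact (symClosure_expresses lts N).sound (hobs h) (.neg hσ) hp
  | conj ι φ _ ih => exact fun i => ih i hq h (hp i)
  | pre a _ ih =>
    obtain ⟨p', ht, hs⟩ := hp
    obtain ⟨q', hq', hsub⟩ := exists_bgo_subset hq h ht
    exact ⟨q', hq', ih (hq.step hq') hsub hs⟩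

theorem logicNS_le_iff {p q : Proc} (hp : lts.ImageFinite p) (hq : lts.ImageFinite q) :
    LogicLE lts (unifiedLogic.{u, v} N .NS) p q ↔ bgo lts N p ⊆ bgo lts N q := by
  constructor
  · intro h θ hθ
    obtain ⟨φ, hφ, hpφ, hφ'⟩ := exists_logicNS.{u, v, w} hp hθ
    exact hφ' q hq (h φ hφ hpφ)
  · exact fun h φ hφ hpφ => LogicNS.sat_of_bgo_subset hφ hq h hpφ

/-! ### Deterministic branching semantics -/

theorem Tree.isDeterministic_node_iff {L : Type w} {l : L} {S : Finset (Act × Tree Act L)} :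
    Tree.IsDeterministic (Tree.node l S) ↔
      (∀ x ∈ S, ∀ y ∈ S, x.1 = y.1 → x = y) ∧ ∀ x ∈ S, Tree.IsDeterministic x.2 := by
  constructor
  · intro h
    generalize hθ : Tree.node l S = θ at h
    cases h with
    | node l' S' h₁ h₂ =>
      obtain ⟨rfl, rfl⟩ := Tree.node_inj.1 hθ
      exact ⟨h₁, h₂⟩
  · exact fun h => .node l S h.1 h.2

theorem exists_logicD {θ : BGO lts N} {p : Proc} (hp : lts.ImageFinite p)
    (hθ : IsBGO lts N p θ) (hdet : θ.IsDeterministic) :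
    ∃ φ : HML.{u, v} Act, LogicD N φ ∧ HML.Sat lts p φ ∧
      ∀ q, lts.ImageFinite q → HML.Sat lts q φ → IsBGO lts N q θ := by
  induction hθ with
  | node p S f hf _ ih =>
    obtain ⟨hinj, hsub⟩ := Tree.isDeterministic_node_iff.1 hdet
    obtain ⟨σ, hσ, hps, hchar⟩ := (symClosure_expresses.{u, v, w} lts N).exists_char hp
    -- Determinism makes the action identify the arc, so the arcs can be indexed by their actions,
    -- as `HML.conjPre` requires.
    have key : ∀ a : {a | ∃ x ∈ S, x.1 = a}, ∃ (x : Act × BGO lts N) (φ : HML.{u, v} Act),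
        x ∈ S ∧ x.1 = a ∧ LogicD N φ ∧ HML.Sat lts (f x) φ ∧
          ∀ q, lts.ImageFinite q → HML.Sat lts q φ → IsBGO lts N q x.2 := by
      rintro ⟨a, x, hx, rfl⟩
      obtain ⟨φ, h⟩ := ih x hx (hp.step (hf x hx)) (hsub x hx)
      exact ⟨x, φ, hx, rfl, h⟩
    choose x φ hx hxa hφ hpφ hφ' using key
    refine ⟨HML.and σ (HML.conjPre {a | ∃ x ∈ S, x.1 = a} φ), .and hσ (.conjPre _ _ hφ),
      HML.sat_and.2 ⟨hps, HML.sat_conjPre.2 fun a => ⟨f (x a), ?_, hpφ a⟩⟩, ?_⟩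
    · rw [← hxa a]
      exact hf _ (hx a)
    · intro q hq hs
      obtain ⟨hs₁, hs₂⟩ := HML.sat_and.1 hs
      refine isBGO_node_iff.2 ⟨hchar q hq hs₁, fun y hy => ?_⟩
      obtain ⟨q', hq', hs'⟩ := HML.sat_conjPre.1 hs₂ ⟨y.1, y, hy, rfl⟩
      have hxy : x ⟨y.1, y, hy, rfl⟩ = y := hinj _ (hx _) _ hy (hxa _)
      have := hφ' _ q' (hq.step hq') hs'
      rw [hxy] at this
      exact ⟨q', hq', this⟩

/-! ### Mergeable sets of observations -/

/-- A set of observations is mergeable if it is nonempty and every two of its elements are implied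
by a third one. -/
structure Mergeable (Θ : Set (BGO lts N)) : Prop where
  nonempty : Θ.Nonempty
  merge {θ₁ θ₂ : BGO lts N} : θ₁ ∈ Θ → θ₂ ∈ Θ → ∃ θ ∈ Θ, bgo lts N ⁻¹' {X | θ ∈ X} ⊆
    bgo lts N ⁻¹' {X | θ₁ ∈ X ∧ θ₂ ∈ X}

/-- If every element of a mergeable set is an observation of one of finitely many processes, then
all elements are observations of the same one of them. -/
theorem Mergeable.exists_subset_bgo {Θ : Set (BGO lts N)} (hΘ : Mergeable Θ) {Q : Set Proc}
    (hQ : Q.Finite) (h : ∀ θ ∈ Θ, ∃ q ∈ Q, θ ∈ bgo lts N q) : ∃ q ∈ Q, Θ ⊆ bgo lts N q := by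
  by_contra! hcon
  -- If no member of `Q` had all of `Θ`, a single element of `Θ` could be built that avoids all of
  -- `Q`. Adding `r`, the element found so far is merged with one that `r` lacks; a process having
  -- the merge has both.
  have key : ∀ Q' : Set Proc, Q'.Finite → Q' ⊆ Q → ∃ θ ∈ Θ, ∀ q ∈ Q', θ ∉ bgo lts N q := by
    intro Q' hQ'
    induction Q', hQ' using Set.Finite.induction_on with
    | empty => exact fun _ => ⟨_, hΘ.nonempty.some_mem, fun q hq => absurd hq (by simp)⟩
    | @insert r Q' _ _ ih =>
      intro hsub
      obtain ⟨θ₁, h₁, h₁'⟩ := ih ((Set.subset_insert r Q').trans hsub)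
      obtain ⟨θ₂, h₂, h₂'⟩ := Set.not_subset.1 (hcon r (hsub (Set.mem_insert r Q')))
      obtain ⟨θ, hθ, hθ'⟩ := hΘ.merge h₁ h₂
      refine ⟨θ, hθ, ?_⟩
      rintro q (rfl | hq) hmem
      · exact h₂' (hθ' hmem).2
      · exact h₁' q hq (hθ' hmem).1
  obtain ⟨θ, hθ, hθ'⟩ := key Q hQ subset_rfl
  obtain ⟨q, hq, hmem⟩ := h θ hθ
  exact hθ' q hq hmem

/-- The observations at `p` that consist of arcs labelled by distinct actions `a ∈ X`, leading to
observations in `Θ a`. -/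
def arcObservations (p : Proc) (X : Set Act) (Θ : X → Set (BGO lts N)) : Set (BGO lts N) :=
  {θ | ∃ S : Finset (Act × BGO lts N), θ = Tree.node (localObs lts N p) S ∧
    (∀ x ∈ S, ∀ y ∈ S, x.1 = y.1 → x = y) ∧ ∀ x ∈ S, ∃ h : x.1 ∈ X, x.2 ∈ Θ ⟨x.1, h⟩}

/-- Each of two deterministic nodes has at most one `a`-arc, so for each action the two subtrees are
merged inside `Θ a`. The merged node again has one arc per action and implies both nodes. -/
theorem mergeable_arcObservations (p : Proc) {X : Set Act} {Θ : X → Set (BGO lts N)}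
    (hΘ : ∀ a, Mergeable (Θ a)) : Mergeable (arcObservations p X Θ) where
  nonempty := ⟨_, ∅, rfl, by simp, by simp⟩
  merge := by
    classical
    rintro _ _ ⟨S₁, rfl, hinj₁, hS₁⟩ ⟨S₂, rfl, hinj₂, hS₂⟩
    have key : ∀ a : X, ∃ θ ∈ Θ a, ∀ x ∈ S₁ ∪ S₂, x.1 = a → ∀ q, θ ∈ bgo lts N q →
        x.2 ∈ bgo lts N q := by
      have aux : ∀ S : Finset (Act × BGO lts N), (∀ x ∈ S, ∀ y ∈ S, x.1 = y.1 → x = y) →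
          (∀ x ∈ S, ∃ h : x.1 ∈ X, x.2 ∈ Θ ⟨x.1, h⟩) → ∀ a : X, ∃ θ ∈ Θ a,
          ∀ x ∈ S, x.1 = a → θ = x.2 := by
        intro S hinj hS a
        by_cases ha : ∃ x ∈ S, x.1 = a
        · obtain ⟨x, hx, hxa⟩ := ha
          obtain ⟨h, hxΘ⟩ := hS x hx
          obtain rfl : (⟨x.1, h⟩ : X) = a := Subtype.ext hxa
          exact ⟨x.2, hxΘ, fun y hy hya => by rw [hinj x hx y hy hya.symm]⟩
        -- Without an `a`-arc in `S` nothing is required, and any element of `Θ a` serves.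
        · obtain ⟨θ, hθ⟩ := (hΘ a).nonempty
          exact ⟨θ, hθ, fun x hx hxa => absurd ⟨x, hx, hxa⟩ ha⟩
      intro a
      obtain ⟨θ₁, h₁, h₁'⟩ := aux S₁ hinj₁ hS₁ a
      obtain ⟨θ₂, h₂, h₂'⟩ := aux S₂ hinj₂ hS₂ a
      obtain ⟨θ, hθ, hθ'⟩ := (hΘ a).merge h₁ h₂
      refine ⟨θ, hθ, fun x hx hxa q hq => ?_⟩
      obtain hx | hx := Finset.mem_union.1 hx
      · rw [← h₁' x hx hxa]
        exact (hθ' hq).1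
      · rw [← h₂' x hx hxa]
        exact (hθ' hq).2
    choose θ hθ hθ' using key
    have hX : ∀ x ∈ S₁ ∪ S₂, x.1 ∈ X := by
      intro x hx
      obtain hx | hx := Finset.mem_union.1 hx
      · exact (hS₁ x hx).1
      · exact (hS₂ x hx).1
    -- The new subtree depends only on the action, so two arcs with the same action become one in
    -- the image.
    have hmem : ∀ y, y ∈ (S₁ ∪ S₂).attach.image (fun x => (x.1.1, θ ⟨x.1.1, hX x.1 x.2⟩)) ↔
        ∃ x, ∃ hx : x ∈ S₁ ∪ S₂, (x.1, θ ⟨x.1, hX x hx⟩) = y := by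
      intro y
      simp only [Finset.mem_image, Finset.mem_attach, true_and, Subtype.exists]
    refine ⟨Tree.node (localObs lts N p)
      ((S₁ ∪ S₂).attach.image fun x => (x.1.1, θ ⟨x.1.1, hX x.1 x.2⟩)), ⟨_, rfl, ?_, ?_⟩, ?_⟩
    · intro y hy z hz hyz
      obtain ⟨x, hx, rfl⟩ := (hmem y).1 hy
      obtain ⟨x', hx', rfl⟩ := (hmem z).1 hz
      have hyz' : x.1 = x'.1 := hyz
      simp only [hyz']
    · intro y hy
      obtain ⟨x, hx, rfl⟩ := (hmem y).1 hy
      exact ⟨hX x hx, hθ _⟩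
    · intro q hq
      obtain ⟨hl, hq⟩ := isBGO_node_iff.1 hq
      have hall : ∀ x ∈ S₁ ∪ S₂, ∃ q', lts.Tr q x.1 q' ∧ IsBGO lts N q' x.2 := by
        intro x hx
        obtain ⟨q', ht, hq'⟩ := hq _ ((hmem _).2 ⟨x, hx, rfl⟩)
        exact ⟨q', ht, hθ' _ x hx rfl q' hq'⟩
      exact ⟨isBGO_node_iff.2 ⟨hl, fun x hx => hall x (Finset.mem_union_left _ hx)⟩,
        isBGO_node_iff.2 ⟨hl, fun x hx => hall x (Finset.mem_union_right _ hx)⟩⟩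

/-- A conjunction over infinitely many actions needs infinitely many finite trees as witnesses.
Mergeability is what lets the induction pass a prefix, where a single successor must have all the
witnesses for the subformula. -/
theorem LogicD.exists_mergeable {φ : HML.{u, v} Act} (hφ : LogicD N φ) {p : Proc}
    (hp : HML.Sat lts p φ) :
    ∃ Θ : Set (BGO lts N), Mergeable Θ ∧ Θ ⊆ dbgo lts N p ∧
      ∀ q, lts.ImageFinite q → Θ ⊆ bgo lts N q → HML.Sat lts q φ := by
  induction hφ generalizing p with
  | top =>
    refine ⟨{Tree.node (localObs lts N p) ∅}, ⟨Set.singleton_nonempty _, ?_⟩, ?_,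
      fun q _ _ => HML.sat_top q⟩
    · rintro _ _ rfl rfl
      exact ⟨_, rfl, fun q hq => ⟨hq, hq⟩⟩
    · rintro _ rfl
      exact ⟨isBGO_empty.2 rfl, .node _ _ (by simp) (by simp)⟩
  | and hσ _ ih =>
    obtain ⟨hs, hs'⟩ := HML.sat_and.1 hp
    obtain ⟨Θ, hΘ, hsub, himp⟩ := ih hs'
    refine ⟨Θ, hΘ, hsub, fun q hq hmem => HML.sat_and.2
      ⟨(symClosure_expresses lts N).sound ?_ hσ hs, himp q hq hmem⟩⟩
    -- Any common observation of `p` and `q` equates their root labels; nonemptiness provides one.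
    obtain ⟨θ, hθ⟩ := hΘ.nonempty
    obtain ⟨S, rfl⟩ := IsBGO.exists_eq_node (hsub hθ).1
    exact (isBGO_node_iff.1 (hmem hθ)).1
  | conjPre X φ _ ih =>
    choose p' ht hs using HML.sat_conjPre.1 hp
    choose Θ hΘ hsub himp using fun a => ih a (hs a)
    refine ⟨arcObservations p X Θ, mergeable_arcObservations p hΘ, ?_, fun q hq hmem =>
      HML.sat_conjPre.2 fun a => ?_⟩
    · rintro _ ⟨S, rfl, hinj, hS⟩
      refine ⟨isBGO_node_iff.2 ⟨rfl, fun x hx => ?_⟩, .node _ _ hinj fun x hx => ?_⟩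
      · obtain ⟨h, hx⟩ := hS x hx
        exact ⟨_, ht ⟨x.1, h⟩, (hsub _ hx).1⟩
      · obtain ⟨h, hx⟩ := hS x hx
        exact (hsub _ hx).2
    -- For each `θ ∈ Θ a` the single-arc tree yields an `a`-successor of `q` having `θ`, which may
    -- vary with `θ`; mergeability and image-finiteness make it uniform.
    · obtain ⟨q', hq', hsub'⟩ := (hΘ a).exists_subset_bgo (hq.finite a) fun θ hθ => by
        have hmem' : IsBGO lts N q (Tree.node (localObs lts N p) {(a.1, θ)}) := by
          refine hmem ⟨_, rfl, ?_, ?_⟩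
          · simp
          · intro x hx
            obtain rfl := Finset.mem_singleton.1 hx
            exact ⟨a.2, hθ⟩
        exact (isBGO_singleton.1 hmem').2
      exact ⟨q', hq', himp a q' (hq.step hq') hsub'⟩

theorem logicD_le_iff {p q : Proc} (hp : lts.ImageFinite p) (hq : lts.ImageFinite q) :
    LogicLE lts (unifiedLogic.{u, v} N .D) p q ↔ dbgo lts N p ⊆ dbgo lts N q := by
  constructor
  · intro h θ hθ
    obtain ⟨φ, hφ, hpφ, hφ'⟩ := exists_logicD.{u, v, w} hp hθ.1 hθ.2
    exact ⟨hφ' q hq (h φ hφ hpφ), hθ.2⟩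
  · intro h φ hφ hpφ
    obtain ⟨Θ, -, hsub, himp⟩ := LogicD.exists_mergeable hφ hpφ
    exact himp q hq fun θ hθ => (h (hsub hθ)).1

end Branching

end ProcessSemantics

/-! ### The theorem, by cases on the semantics -/

theorem theorem7 {Proc : Type w} {Act : Type u} (lts : ProcessSemantics.LTS Proc Act)
    (N : ProcessSemantics.Constraint) (Y : ProcessSemantics.Sem)
    (p q : Proc) (hp : lts.ImageFinite p) (hq : lts.ImageFinite q) :
    ProcessSemantics.LogicLE lts (ProcessSemantics.unifiedLogic.{u, v} N Y) p q ↔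
      ProcessSemantics.ObsLE lts N Y p q := by
  open ProcessSemantics in
  cases Y with
  | NS => exact logicNS_le_iff hp hq
  | l =>
    rw [unifiedLogic_l]
    exact (chainLogic_le_iff (symClosure_expresses lts N) hp hq).trans lgo_subset_iff.symm
  | lsup =>
    rw [unifiedLogic_lsup]
    exact chainLogic_le_iff (negClosure_expresses lts N) hp hq
  | lf =>
    rw [unifiedLogic_lf]
    exact finalLogic_le_iff (symClosure_expresses lts N) hp hq
  | lfsup =>
    rw [unifiedLogic_lfsup]
    exact finalLogic_le_iff (negClosure_expresses lts N) hp hq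
  | D => exact logicD_le_iff hp hq
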